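/- Let $\mathcal Y\subseteq\mathbb R^d$ and consider loss functions $L:\mathcal Y\times\mathcal Y\to\mathbb R$. A Borel probability distribution of labels $T$ in $\mathcal Y$ is valid if $\mathbb E\,|L(T,y)|<\infty$ for all $y\in\mathcal Y$, and a distribution of predictions $Y$ in $\mathcal Y$ is valid if $\mathbb E\,|L(t,Y)|<\infty$ for all $t\in\mathcal Y$. The loss $L$ has a *clean bias-variance decomposition* if to every valid label distribution one can assign a central label $t^*\in\operatorname{argmin}_{y\in\mathcal Y}\mathbb E\,L(T,y)$ (depending only on the distribution of $T$) and to every valid prediction distribution a central prediction $y^*\in\operatorname{argmin}_{t\in\mathcal Y}\mathbb E\,L(t,Y)$ (depending only on the distribution of $Y$), such that for all independent $T,Y$ with valid distributions $L(T,Y)$ is integrable and $$\mathbb E\,L(T,Y)=\mathbb E\,L(T,t^*)+L(t^*,y^*)+\mathbb E\,L(y^*,Y).$$ 1. Suppose that $\mathcal Y$ is $\sigma$-compact (for instance open or closed in $\mathbb R^d$). Let $L$ be continuous and nonnegative, with $L(t,y)=0$ if and only if $t=y$. Then $L$ is symmetric and has a clean bias-variance decomposition if and only if it is a $g$-generalized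 squared Mahalanobis distance $$L(t,y)=(g(t)-g(y))^\top K\,(g(t)-g(y))$$ for some symmetric positive definite matrix $K\in\mathbb R^{d\times d}$ and some mapping $g:\mathcal Y\to\mathbb R^d$ that is invertible onto its image $g(\mathcal Y)$ and whose image is convex. 2. Suppose that $\mathcal Y$ (not necessarily $\sigma$-compact) has at least two points. Then no metric on $\mathcal Y$, whether continuous or not, has a clean bias-variance decomposition. In particular neither the 0-1 loss $L(t,y)=\mathbf 1[t\neq y]$ nor the $L_1$ loss $L(t,y)=\sum_i|t_i-y_i|$ on $\mathcal Y$ has one. -/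

import Mathlib

open MeasureTheory

/-- A distribution of labels is valid for the loss `L` if the expected loss of every
prediction is finite. -/
def ValidLabelLaw {α : Type*} [MeasurableSpace α] (L : α → α → ℝ)
    (P : ProbabilityMeasure α) : Prop :=
  ∀ y : α, Integrable (fun t => L t y) (P : Measure α)

/-- A distribution of predictions is valid for the loss `L` if its expected loss against every
label is finite. -/
def ValidPredictionLaw {α : Type*} [MeasurableSpace α] (L : α → α → ℝ)
    (Q : ProbabilityMeasure α) : Prop :=
  ∀ t : α, Integrable (fun y => L t y) (Q : Measure α)

/-- `s` minimizes the intrinsic noise `y ↦ E_T L(T, y)` over the whole domain. -/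
def IsCentralLabel {α : Type*} [MeasurableSpace α] (L : α → α → ℝ)
    (P : ProbabilityMeasure α) (s : α) : Prop :=
  ∀ y : α, ∫ t, L t s ∂(P : Measure α) ≤ ∫ t, L t y ∂(P : Measure α)

/-- `s` minimizes the variance `t ↦ E_Y L(t, Y)` over the whole domain. -/
def IsCentralPrediction {α : Type*} [MeasurableSpace α] (L : α → α → ℝ)
    (Q : ProbabilityMeasure α) (s : α) : Prop :=
  ∀ t : α, ∫ y, L s y ∂(Q : Measure α) ≤ ∫ y, L t y ∂(Q : Measure α)

/-- Clean bias-variance decomposition: every valid label law `P` has a central label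
`tc P`, every valid prediction law `Q` has a central prediction `yc Q`, and for independent
`T ∼ P`, `Y ∼ Q` the expected loss is finite and equals noise + bias + variance. -/
def HasCleanDecomposition {α : Type*} [MeasurableSpace α] (L : α → α → ℝ) : Prop :=
  ∃ tc yc : ProbabilityMeasure α → α,
    (∀ P, ValidLabelLaw L P → IsCentralLabel L P (tc P)) ∧
    (∀ Q, ValidPredictionLaw L Q → IsCentralPrediction L Q (yc Q)) ∧
    ∀ P Q : ProbabilityMeasure α, ValidLabelLaw L P → ValidPredictionLaw L Q →
      Integrable (fun p : α × α => L p.1 p.2) ((P : Measure α).prod (Q : Measure α)) ∧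
      ∫ p : α × α, L p.1 p.2 ∂((P : Measure α).prod (Q : Measure α)) =
        ∫ t, L t (tc P) ∂(P : Measure α) + L (tc P) (yc Q) + ∫ y, L (yc Q) y ∂(Q : Measure α)

/-- Nonnegativity together with the identity of indiscernibles. -/
structure IsLoss {α : Type*} (L : α → α → ℝ) : Prop where
  nonneg : ∀ t y, 0 ≤ L t y
  eq_zero_iff : ∀ t y, L t y = 0 ↔ t = y

/-- A metric, as a loss function. -/
structure IsMetricLoss {α : Type*} (L : α → α → ℝ) : Prop extends IsLoss L where
  symm : ∀ t y, L t y = L y t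
  triangle : ∀ t s y, L t y ≤ L t s + L s y

/-- The squared Mahalanobis distance `(g t - g y)ᵀ K (g t - g y)` after the mapping `g`. -/
def mahalanobisLoss {α : Type*} {d : ℕ} (g : α → Fin d → ℝ) (K : Matrix (Fin d) (Fin d) ℝ)
    (t y : α) : ℝ :=
  (g t - g y) ⬝ᵥ (K.mulVec (g t - g y))

open Classical in
/-- The zero-one loss. -/
noncomputable def zeroOneLoss {α : Type*} (t y : α) : ℝ := if t = y then 0 else 1

/-- The `L₁` (Manhattan) loss on a subset of Euclidean space. -/
noncomputable def manhattanLoss {d : ℕ} {Y : Set (EuclideanSpace ℝ (Fin d))} (t y : Y) : ℝ :=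
  ∑ i, |t.1 i - y.1 i|

/-!
Only very simple laws are needed to exploit a clean decomposition. Let the label take the value `a`
with probability `w` and `b` with probability `1 - w`, and let the prediction be a constant `y`. As
`L` vanishes exactly on the diagonal, the central prediction is `y`, and the decomposition says that
the expected loss of `y` is a constant plus `L m y` for a central label `m`
(`HasCleanDecomposition.exists_center`). For symmetric `L` the choices `y = a` and `y = b` identify
the constant as `w (1 - w) L a b` (`HasCleanDecomposition.exists_barycenter`). For a metric and
`w = 1 / 2` this constant is `L a b / 4`, but by the triangle inequality it is at least `L a b / 2`.
This settles metrics.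

For a symmetric loss, fix a point `o` and polarise `L` to a kernel
`k t y = (L t o + L y o - L t y) / 2`. The barycenters `m` say that the sections `k a ·` form a
convex set containing `0`. Any linear combination of them is therefore of the form
`M (k a · - k b ·)`, and the quadratic form of the kernel takes the value `M ^ 2 L a b ≥ 0`. So the
kernel is positive semidefinite and `L t y = ‖φ t - φ y‖ ^ 2` for a map `φ` into a reproducing
kernel Hilbert space; the barycenters make its range convex.

It remains to bound the dimension of the range of `φ` by `d`. If the range had larger dimension, it
would contain a simplex of dimension `d + 1`. By σ-compactness and Baire's theorem the inverse of
`φ` would be continuous on a ball of this simplex, which would thus embed into `ℝ ^ d`. This is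
impossible (`not_injective_of_continuous_closedBall`): the inverse of such an embedding, smoothly
approximated, would have a range of measure zero, and this leads to a `C¹` retraction of the ball
onto its sphere. The latter is excluded by the analytic argument of Milnor and Rogers
(`not_contDiff_retraction_sphere`).

Conversely, a Mahalanobis loss is a squared Euclidean distance after a map `φ` with convex range.
The mean of `φ` under a valid law lies in this convex range, closed or not
(`Convex.integral_mem_of_finrank`), and its preimage is the central point; the decomposition is the
parallel axis identity applied twice.
-/

/-! ### Nonexistence of a smooth retraction onto the sphere, and invariance of dimension -/

/-- Lagrange interpolation at nodes near `0`: the value at `1` of a polynomial of bounded degree is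
a fixed linear combination of its values at finitely many small positive numbers. -/
theorem exists_interpolation_nodes (N : ℕ) {ε : ℝ} (hε : 0 < ε) :
    ∃ (s : Finset ℝ) (c : ℝ → ℝ), (∀ t ∈ s, 0 < t ∧ t < ε) ∧
      ∀ p : Polynomial ℝ, p.natDegree ≤ N → p.eval 1 = ∑ t ∈ s, c t * p.eval t := by
  obtain ⟨s, hs, hcard⟩ := (Set.Ioo_infinite hε).exists_subset_card_eq (N + 1)
  refine ⟨s, fun t => (Lagrange.basis s id t).eval 1, fun t ht => hs ht, fun p hp => ?_⟩
  have hdeg : p.degree < s.card := by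
    rw [hcard]
    exact lt_of_le_of_lt Polynomial.degree_le_natDegree (by exact_mod_cast Nat.lt_succ_of_le hp)
  have h := Lagrange.eq_interpolate (v := id) (s := s) (Function.injective_id.injOn) hdeg
  conv_lhs => rw [h]
  simp [Lagrange.interpolate_apply, Polynomial.eval_finsetSum, mul_comm]

open Polynomial in
theorem ContinuousLinearMap.exists_polynomial_det_one_add_smul {E : Type*} [NormedAddCommGroup E]
    [NormedSpace ℝ E] [FiniteDimensional ℝ E] (A : E →L[ℝ] E) :
    ∃ p : ℝ[X], p.natDegree ≤ Module.finrank ℝ E ∧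
      ∀ t : ℝ, p.eval t = (ContinuousLinearMap.id ℝ E + t • A).det := by
  let b := Module.finBasis ℝ E
  let M := LinearMap.toMatrix b b (A : E →ₗ[ℝ] E)
  refine ⟨((X : ℝ[X]) • M.map C + (1 : Matrix _ _ ℝ).map C).det, ?_, fun t => ?_⟩
  · simpa using natDegree_det_X_add_C_le M 1
  · rw [ContinuousLinearMap.det, ← LinearMap.det_toMatrix b, ← coe_evalRingHom,
      RingHom.map_det]
    congr 1
    have h : LinearMap.toMatrix b b ((ContinuousLinearMap.id ℝ E + t • A : E →L[ℝ] E) : E →ₗ[ℝ] E)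
        = 1 + t • M := by
      rw [ContinuousLinearMap.toLinearMap_add, ContinuousLinearMap.toLinearMap_smul, map_add,
        map_smul]
      congr 1
      exact LinearMap.toMatrix_id b
    rw [h]
    ext i j
    simp only [Matrix.smul_apply, Matrix.add_apply, Matrix.map_apply, RingHom.mapMatrix_apply,
      coe_evalRingHom, eval_add, smul_eq_mul, eval_mul, eval_X, eval_C]
    ring

/-- The determinant does not vanish on the segment from `id` to `id + A`. -/
theorem ContinuousLinearMap.det_id_add_pos {E : Type*} [NormedAddCommGroup E]
    [NormedSpace ℝ E] [FiniteDimensional ℝ E] (A : E →L[ℝ] E) (hA : ‖A‖ < 1) :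
    0 < (ContinuousLinearMap.id ℝ E + A).det := by
  have hne : ∀ s ∈ Set.Icc (0 : ℝ) 1, (ContinuousLinearMap.id ℝ E + s • A).det ≠ 0 := by
    intro s hs h0
    have hlt : ‖-(s • A)‖ < 1 := by
      rw [norm_neg, norm_smul, Real.norm_of_nonneg hs.1]
      nlinarith [hs.1, hs.2, norm_nonneg A]
    have hker : ∀ x, (ContinuousLinearMap.id ℝ E + s • A) x = 0 → x = 0 := by
      intro x hx
      by_contra hx0
      have h1 : x = (-(s • A)) x := by
        simp at hx ⊢
        exact eq_neg_of_add_eq_zero_left hx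
      have h2 := (-(s • A)).le_opNorm x
      rw [← h1] at h2
      nlinarith [norm_pos_iff.2 hx0]
    exact (LinearMap.bot_lt_ker_of_det_eq_zero h0).ne'
      (LinearMap.ker_eq_bot'.2 fun x hx => hker x hx)
  by_contra! hle
  have hc : Continuous fun s : ℝ => (ContinuousLinearMap.id ℝ E + s • A).det :=
    ContinuousLinearMap.continuous_det.comp (by fun_prop)
  have h0 : (ContinuousLinearMap.id ℝ E + (0 : ℝ) • A).det = 1 := by
    simp [ContinuousLinearMap.det]
  obtain ⟨s, hs, hs0⟩ := intermediate_value_Icc' zero_le_one hc.continuousOn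
    (show (0 : ℝ) ∈ Set.Icc _ _ from ⟨by simpa using hle, by rw [h0]; exact zero_le_one⟩)
  exact hne s hs hs0

/-- There is no `C¹` retraction of the unit ball onto the unit sphere. With `u = r - id`, the map
`id + t u` permutes the open ball for small `t > 0`, so the integral of its Jacobian over the ball
is the volume of the ball. This integral is a polynomial in `t`, hence it is the volume also for
`t = 1`; but the Jacobian of `r` vanishes identically. -/
theorem not_contDiff_retraction_sphere {E : Type*} [NormedAddCommGroup E]
    [InnerProductSpace ℝ E] [FiniteDimensional ℝ E] [Nontrivial E] {r : E → E}
    (hr : ContDiff ℝ 1 r) (hsphere : ∀ x, ‖x‖ = 1 → r x = x)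
    (hnorm : ∀ x, ‖x‖ ≤ 1 → ‖r x‖ = 1) : False := by
  let _ : MeasurableSpace E := borel E
  have _ : BorelSpace E := ⟨rfl⟩
  set U : Set E := Metric.ball 0 1 with hU
  set u : E → E := fun x => r x - x with hu
  have hcu : ContDiff ℝ 1 u := hr.sub contDiff_id
  obtain ⟨K, hK⟩ : ∃ K, LipschitzOnWith K u (Metric.closedBall 0 1) := by
    exact hcu.locallyLipschitz.locallyLipschitzOn.exists_lipschitzOnWith_of_compact
      (isCompact_closedBall 0 1)
  have hu0 : ∀ x, ‖x‖ = 1 → u x = 0 := fun x hx => by simp [hu, hsphere x hx]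
  -- a point of the ball moves by at most `K` times its distance to the sphere
  have hbound : ∀ x, ‖x‖ ≤ 1 → ‖u x‖ ≤ K * (1 - ‖x‖) := by
    intro x hx
    obtain ⟨z, hz, hxz⟩ : ∃ z : E, ‖z‖ = 1 ∧ ‖x - z‖ = 1 - ‖x‖ := by
      rcases eq_or_ne x 0 with rfl | h0
      · obtain ⟨z, hz⟩ := exists_norm_eq E zero_le_one
        exact ⟨z, hz, by simp [hz]⟩
      · have hpos := norm_pos_iff.2 h0
        refine ⟨‖x‖⁻¹ • x, by simp [norm_smul, hpos.ne'], ?_⟩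
        have : x - ‖x‖⁻¹ • x = (1 - ‖x‖⁻¹) • x := by rw [sub_smul, one_smul]
        rw [this, norm_smul, Real.norm_of_nonpos (by linarith [(one_le_inv₀ hpos).2 hx])]
        field_simp
        ring
    have := hK.norm_sub_le (show x ∈ Metric.closedBall 0 1 by simpa using hx)
      (show z ∈ Metric.closedBall 0 1 by simp [hz])
    rwa [hu0 z hz, sub_zero, hxz] at this
  -- the displacement extended by zero outside the ball is Lipschitz on the whole space
  let v : E → E := fun x => if ‖x‖ ≤ 1 then u x else 0
  have hv : LipschitzWith K v := by
    refine LipschitzWith.of_dist_le_mul fun x y => ?_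
    rw [dist_eq_norm, dist_eq_norm]
    have key : ∀ a b : E, ‖a‖ ≤ 1 → ¬ ‖b‖ ≤ 1 → ‖u a‖ ≤ K * ‖a - b‖ := by
      intro a b ha hb
      refine (hbound a ha).trans (mul_le_mul_of_nonneg_left ?_ K.2)
      have := norm_sub_norm_le b a
      rw [norm_sub_rev] at this
      linarith
    by_cases hx : ‖x‖ ≤ 1 <;> by_cases hy : ‖y‖ ≤ 1
    · simpa [v, hx, hy] using hK.norm_sub_le (show x ∈ Metric.closedBall 0 1 by simpa using hx)
        (show y ∈ Metric.closedBall 0 1 by simpa using hy)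
    · simpa [v, hx, hy] using key x y hx hy
    · simpa [v, hx, hy, norm_sub_rev] using key y x hy hx
    · simp only [v, hx, hy, if_false, sub_zero, norm_zero]
      positivity
  have hfd : ∀ x, HasFDerivAt u (fderiv ℝ u x) x := fun x =>
    (hcu.differentiable one_ne_zero x).hasFDerivAt
  have hA : ∀ x ∈ U, ‖fderiv ℝ u x‖ ≤ K := fun x hx =>
    norm_fderiv_le_of_lipschitzOn ℝ (Metric.isOpen_ball.mem_nhds hx)
      (hK.mono Metric.ball_subset_closedBall)
  -- the Jacobian determinant of `id + t u`
  let J : ℝ → E → ℝ := fun t x => (ContinuousLinearMap.id ℝ E + t • fderiv ℝ u x).det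
  have hJint : ∀ t, IntegrableOn (J t) U volume := by
    intro t
    have hc : Continuous (J t) := ContinuousLinearMap.continuous_det.comp
      (continuous_const.add ((hcu.continuous_fderiv one_ne_zero).const_smul t))
    exact (hc.continuousOn.integrableOn_compact (isCompact_closedBall (0 : E) 1)).mono_set
      Metric.ball_subset_closedBall
  -- for small times the homotopy from the identity to `r` permutes the ball
  have hsmall : ∀ t : ℝ, 0 < t → t < (K + 1 : ℝ)⁻¹ →
      ∫ x in U, J t x = (volume U).toReal := by
    intro t ht htK
    have hK1 : (0 : ℝ) < K + 1 := by positivity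
    have htK' : t * K < 1 := by
      have := mul_lt_mul_of_pos_right htK hK1
      rw [inv_mul_cancel₀ hK1.ne'] at this
      nlinarith
    have ht1 : t < 1 := htK.trans_le (inv_le_one_of_one_le₀ (by linarith [K.2]))
    have hinj : Set.InjOn (fun x => x + t • u x) U := by
      intro x hx y hy hxy
      have h1 := hK.norm_sub_le (Metric.ball_subset_closedBall hx)
        (Metric.ball_subset_closedBall hy)
      have h2 : x - y = -(t • (u x - u y)) := by
        have : x + t • u x = y + t • u y := hxy
        rw [← sub_eq_zero] at this ⊢
        rw [← this]
        module
      have h3 : ‖x - y‖ ≤ (t * K) * ‖x - y‖ := by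
        conv_lhs => rw [h2, norm_neg, norm_smul, Real.norm_of_nonneg ht.le]
        rw [mul_assoc]
        exact mul_le_mul_of_nonneg_left h1 ht.le
      have h4 : ‖x - y‖ = 0 := by nlinarith [norm_nonneg (x - y)]
      exact sub_eq_zero.1 (norm_eq_zero.1 h4)
    have himg : (fun x => x + t • u x) '' U = U := by
      apply Set.Subset.antisymm
      · rintro _ ⟨x, hx, rfl⟩
        have hx1 : ‖x‖ < 1 := by simpa [hU] using hx
        have h1 : x + t • u x = (1 - t) • x + t • r x := by
          simp only [hu, smul_sub, sub_smul, one_smul]; abel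
        have h2 : ‖(1 - t) • x + t • r x‖ ≤ (1 - t) * ‖x‖ + t * 1 := by
          refine (norm_add_le _ _).trans (le_of_eq ?_)
          rw [norm_smul, norm_smul, hnorm x hx1.le, Real.norm_of_nonneg ht.le,
            Real.norm_of_nonneg (by linarith)]
        simp only [hU, mem_ball_zero_iff]
        rw [h1]
        nlinarith
      · intro y hy
        have hy1 : ‖y‖ < 1 := by simpa [hU] using hy
        -- a preimage of `y` is a fixed point of the contraction `x ↦ y - t v x`
        have hcontr : ContractingWith ⟨t * K, by positivity⟩ (fun x => y - t • v x) := by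
          refine ⟨by exact_mod_cast htK', LipschitzWith.of_dist_le_mul fun a b => ?_⟩
          have h1 := hv.dist_le_mul a b
          rw [dist_eq_norm] at h1
          rw [dist_sub_left, dist_eq_norm, ← smul_sub, norm_smul, Real.norm_of_nonneg ht.le]
          change _ ≤ t * K * dist a b
          rw [mul_assoc]
          exact mul_le_mul_of_nonneg_left h1 ht.le
        have hfix := hcontr.fixedPoint_isFixedPt
        set x := hcontr.fixedPoint
        have hx : y - t • v x = x := hfix
        have hx1 : ‖x‖ < 1 := by
          by_contra! hge
          have : v x = 0 := by
            by_cases h : ‖x‖ ≤ 1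
            · simp [v, h, hu0 x (le_antisymm h hge)]
            · simp [v, h]
          rw [this, smul_zero, sub_zero] at hx
          rw [hx] at hy1
          linarith
        refine ⟨x, by simpa [hU] using hx1, ?_⟩
        have : v x = u x := by simp [v, hx1.le]
        rw [this] at hx
        exact (sub_eq_iff_eq_add.1 hx).symm
    have hcov := integral_image_eq_integral_abs_det_fderiv_smul (volume : Measure E)
      (measurableSet_ball : MeasurableSet U)
      (f := fun x => x + t • u x) (f' := fun x => ContinuousLinearMap.id ℝ E + t • fderiv ℝ u x)
      (fun x _ => ((hasFDerivAt_id x).add ((hfd x).const_smul t)).hasFDerivWithinAt) hinj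
      (fun _ => (1 : ℝ))
    rw [himg] at hcov
    have hJ : ∫ x in U, J t x = ∫ x in U,
        |(ContinuousLinearMap.id ℝ E + t • fderiv ℝ u x).det| • (1 : ℝ) := by
      refine setIntegral_congr_fun measurableSet_ball fun x hx => ?_
      have hlt : ‖t • fderiv ℝ u x‖ < 1 := by
        rw [norm_smul, Real.norm_of_nonneg ht.le]
        exact (mul_le_mul_of_nonneg_left (hA x hx) ht.le).trans_lt htK'
      simp only [J, smul_eq_mul, mul_one]
      rw [abs_of_pos (ContinuousLinearMap.det_id_add_pos _ hlt)]
    rw [hJ, ← hcov]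
    simp [Measure.real]
  obtain ⟨s, c, hs, hc⟩ := exists_interpolation_nodes (Module.finrank ℝ E)
    (show (0 : ℝ) < (K + 1 : ℝ)⁻¹ by positivity)
  have hsum : ∑ t ∈ s, c t = 1 := by
    simpa using (hc 1 (by simp)).symm
  have hvol : ∫ x in U, J 1 x = (volume U).toReal := by
    have h1 : ∀ x, J 1 x = ∑ t ∈ s, c t * J t x := by
      intro x
      obtain ⟨p, hp, hpe⟩ := (fderiv ℝ u x).exists_polynomial_det_one_add_smul
      simp only [J, ← hpe]
      exact hc p hp
    simp_rw [h1]
    rw [integral_finsetSum _ fun t _ => (hJint t).const_mul (c t)]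
    simp_rw [integral_const_mul]
    rw [Finset.sum_congr rfl fun t ht => by rw [hsmall t (hs t ht).1 (hs t ht).2],
      ← Finset.sum_mul, hsum, one_mul]
  -- the derivative of a map into the sphere is singular
  have hzero : ∀ x ∈ U, J 1 x = 0 := by
    intro x hx
    have hder : ContinuousLinearMap.id ℝ E + (1 : ℝ) • fderiv ℝ u x = fderiv ℝ r x := by
      have h := ((hasFDerivAt_id x).add (hfd x))
      have h' : (id + u) = r := by ext y; simp [hu]
      rw [h'] at h
      rw [one_smul, h.fderiv]
    have hrd : HasFDerivAt r (fderiv ℝ r x) x := (hr.differentiable one_ne_zero x).hasFDerivAt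
    have hort : ∀ w, inner ℝ (r x) (fderiv ℝ r x w) = 0 := by
      intro w
      have h1 : HasFDerivAt (fun y => ‖r y‖ ^ 2) (2 • (innerSL ℝ (r x)).comp (fderiv ℝ r x)) x :=
        hrd.norm_sq
      have h2 : (fun y => ‖r y‖ ^ 2) =ᶠ[nhds x] fun _ => (1 : ℝ) := by
        filter_upwards [Metric.isOpen_ball.mem_nhds hx] with y hy
        rw [hnorm y (by simpa using (Metric.ball_subset_closedBall hy))]
        norm_num
      have h3 := (h1.congr_of_eventuallyEq h2.symm).unique (hasFDerivAt_const (1 : ℝ) x)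
      have h4 := DFunLike.congr_fun h3 w
      simpa using h4
    simp only [J, hder]
    by_contra hdet
    have hunit : IsUnit (LinearMap.det (fderiv ℝ r x : E →ₗ[ℝ] E)) := isUnit_iff_ne_zero.2 hdet
    obtain ⟨w, hw⟩ := ((LinearMap.isUnit_iff_isUnit_det _).2 hunit |>
      (Module.End.isUnit_iff _).1).2 (r x)
    have h5 := hort w
    rw [show fderiv ℝ r x w = r x from hw, real_inner_self_eq_norm_sq,
      hnorm x (by simpa using (Metric.ball_subset_closedBall hx))] at h5
    norm_num at h5
  have h0 : ∫ x in U, J 1 x = 0 := by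
    rw [setIntegral_congr_fun measurableSet_ball hzero]
    simp
  rw [h0] at hvol
  exact (ENNReal.toReal_pos (Metric.measure_ball_pos volume 0 one_pos).ne'
    measure_ball_lt_top.ne).ne hvol

/-- Invariance of dimension: a ball does not embed into a space of smaller dimension. A smooth
approximation `g` of a continuous extension of the inverse misses points `c` arbitrarily close to
the origin, so `x ↦ g (f x) - c` is close to the identity on the ball but has no zero. Smoothing it
once more, gluing it to the identity near the sphere and normalizing yields a forbidden
retraction. -/
theorem not_injective_of_continuous_closedBall {E F : Type*} [NormedAddCommGroup E]
    [InnerProductSpace ℝ E] [FiniteDimensional ℝ E] [NormedAddCommGroup F] [NormedSpace ℝ F]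
    [FiniteDimensional ℝ F] (hdim : Module.finrank ℝ F < Module.finrank ℝ E) 
    {f : Metric.closedBall (0 : E) 1 → F} (hf : Continuous f) : ¬ Function.Injective f := by
  intro hinj
  have : Nontrivial E := Module.nontrivial_of_finrank_pos (R := ℝ) (by omega)
  let B : Set E := Metric.closedBall 0 1
  have : CompactSpace B := isCompact_iff_compactSpace.1 (isCompact_closedBall 0 1)
  have hemb : Topology.IsClosedEmbedding f := hf.isClosedEmbedding hinj
  obtain ⟨f', hf'⟩ := ContinuousMap.exists_extension'
    (Metric.isClosed_closedBall : IsClosed B).isClosedEmbedding_subtypeVal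
    ⟨f, hf⟩
  obtain ⟨G, hG⟩ := ContinuousMap.exists_extension' hemb
    (⟨Subtype.val, continuous_subtype_val⟩ : C(B, E))
  have hGf : ∀ x ∈ B, G (f' x) = x := by
    intro x hx
    have h1 : f' x = f ⟨x, hx⟩ := congrFun hf' ⟨x, hx⟩
    have h2 : G (f ⟨x, hx⟩) = x := congrFun hG ⟨x, hx⟩
    rw [h1, h2]
  obtain ⟨g, hg, hgG, -⟩ := G.continuous.exists_contDiff_approx 1
    (continuous_const (y := (1 / 8 : ℝ))) (fun _ => by norm_num)
  obtain ⟨c, hc, hc8⟩ := (hg.dense_compl_range_of_finrank_lt_finrank hdim).exists_dist_lt (0 : E)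
    (show (0 : ℝ) < 1 / 8 by norm_num)
  rw [dist_zero_left] at hc8
  let h : E → E := fun x => g (f' x) - c
  have hcont : Continuous h := (hg.continuous.comp f'.continuous).sub continuous_const
  have hne : ∀ x, h x ≠ 0 := fun x hx => hc ⟨f' x, sub_eq_zero.1 hx⟩
  have hclose : ∀ x ∈ B, ‖h x - x‖ < 1 / 4 := by
    intro x hx
    have h1 := hgG (f' x)
    rw [hGf x hx, dist_eq_norm] at h1
    have : h x - x = (g (f' x) - x) - c := by simp only [h]; abel
    rw [this]
    linarith [norm_sub_le (g (f' x) - x) c]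
  -- the error bound `‖h x‖` keeps the smooth approximation nonvanishing
  obtain ⟨k, hk, hkh, -⟩ := hcont.exists_contDiff_approx 1 (ε := fun x => min (1 / 4) ‖h x‖)
    (continuous_const.min hcont.norm) (fun x => lt_min (by norm_num) (norm_pos_iff.2 (hne x)))
  have hkne : ∀ x, k x ≠ 0 := by
    intro x hx
    have := (hkh x).trans_le (min_le_right _ _)
    rw [hx, dist_zero_left] at this
    exact lt_irrefl _ this
  have hkclose : ∀ x ∈ B, ‖k x - x‖ < 1 / 2 := by
    intro x hx
    have h1 := (hkh x).trans_le (min_le_left _ _)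
    rw [dist_eq_norm] at h1
    have h2 := hclose x hx
    have : k x - x = (k x - h x) + (h x - x) := by abel
    rw [this]
    linarith [norm_add_le (k x - h x) (h x - x)]
  let χ : ContDiffBump (0 : E) := ⟨1 / 2, 1, by norm_num, by norm_num⟩
  let H : E → E := fun x => x + χ x • (k x - x)
  have hH : ContDiff ℝ 1 H := contDiff_id.add (χ.contDiff.smul (hk.sub contDiff_id))
  have hHout : ∀ x, 1 ≤ ‖x‖ → H x = x := by
    intro x hx
    have : χ x = 0 := χ.zero_of_le_dist (by simpa [χ] using hx)
    simp [H, this]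
  have hHne : ∀ x, H x ≠ 0 := by
    intro x hx
    rcases le_or_gt ‖x‖ (1 / 2) with h1 | h1
    · have : χ x = 1 := χ.one_of_mem_closedBall (by simpa [χ] using h1)
      exact hkne x (by simpa [H, this] using hx)
    · rcases le_or_gt 1 ‖x‖ with h2 | h2
      · rw [hHout x h2] at hx
        simp [hx] at h2
        linarith
      · have h3 := hkclose x (by simpa [B] using h2.le)
        have h4 : x = -(χ x • (k x - x)) := eq_neg_of_add_eq_zero_left hx
        have h5 : ‖x‖ ≤ ‖k x - x‖ := by
          conv_lhs => rw [h4, norm_neg, norm_smul, Real.norm_of_nonneg χ.nonneg]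
          exact mul_le_of_le_one_left (norm_nonneg _) χ.le_one
        linarith
  refine not_contDiff_retraction_sphere (r := fun x => ‖H x‖⁻¹ • H x)
    (((hH.norm ℝ hHne).inv fun x => norm_ne_zero_iff.2 (hHne x)).smul hH) ?_ ?_
  · intro x hx
    simp [hHout x hx.ge, hx]
  · intro x _
    simp [norm_smul, norm_ne_zero_iff.2 (hHne x)]

/-! ### Two-point laws -/

section TwoPointLaws

variable {α : Type*} [MeasurableSpace α]

/-- The law putting mass `w` at `a` and mass `1 - w` at `b`. -/
noncomputable def twoPointLaw (a b : α) (w : ℝ) (hw : w ∈ Set.Icc (0 : ℝ) 1) :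
    ProbabilityMeasure α :=
  ⟨ENNReal.ofReal w • Measure.dirac a + ENNReal.ofReal (1 - w) • Measure.dirac b, ⟨by
    simp [← ENNReal.ofReal_add hw.1 (sub_nonneg.2 hw.2)]⟩⟩

/-- The law of a deterministic quantity. -/
noncomputable def pointLaw (y : α) : ProbabilityMeasure α := ⟨Measure.dirac y, inferInstance⟩

theorem twoPointLaw_prod_pointLaw {a b y : α} {w : ℝ} (hw : w ∈ Set.Icc (0 : ℝ) 1) :
    (twoPointLaw a b w hw : Measure α).prod (pointLaw y : Measure α) =
      (twoPointLaw (a, y) (b, y) w hw : Measure (α × α)) := by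
  change (ENNReal.ofReal w • Measure.dirac a + ENNReal.ofReal (1 - w) • Measure.dirac b).prod
    (Measure.dirac y) = ENNReal.ofReal w • Measure.dirac (a, y) +
      ENNReal.ofReal (1 - w) • Measure.dirac (b, y)
  rw [Measure.add_prod, Measure.prod_smul_left, Measure.prod_smul_left, Measure.dirac_prod_dirac,
    Measure.dirac_prod_dirac]

variable [MeasurableSingletonClass α]

theorem integrable_twoPointLaw (f : α → ℝ) {a b : α} {w : ℝ} (hw : w ∈ Set.Icc (0 : ℝ) 1) :
    Integrable f (twoPointLaw a b w hw : Measure α) :=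
  ((integrable_dirac (by simp)).smul_measure ENNReal.ofReal_ne_top).add_measure
    ((integrable_dirac (by simp)).smul_measure ENNReal.ofReal_ne_top)

theorem integral_twoPointLaw (f : α → ℝ) {a b : α} {w : ℝ} (hw : w ∈ Set.Icc (0 : ℝ) 1) :
    ∫ t, f t ∂(twoPointLaw a b w hw : Measure α) = w * f a + (1 - w) * f b := by
  change ∫ t, f t ∂(ENNReal.ofReal w • Measure.dirac a + ENNReal.ofReal (1 - w) • Measure.dirac b)
    = _
  rw [integral_add_measure ((integrable_dirac (by simp)).smul_measure ENNReal.ofReal_ne_top)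
    ((integrable_dirac (by simp)).smul_measure ENNReal.ofReal_ne_top)]
  simp [ENNReal.toReal_ofReal hw.1, ENNReal.toReal_ofReal (sub_nonneg.2 hw.2)]

theorem integral_pointLaw (f : α → ℝ) (y : α) : ∫ t, f t ∂(pointLaw y : Measure α) = f y :=
  integral_dirac f y

/-- The decomposition for a two-point label law and a deterministic prediction `y`. Since the loss
vanishes only on the diagonal, `y` is its own central prediction and has no variance. -/
theorem HasCleanDecomposition.exists_center {L : α → α → ℝ} (hL : IsLoss L)
    (h : HasCleanDecomposition L) (a b : α) {w : ℝ} (hw : w ∈ Set.Icc (0 : ℝ) 1) :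
    ∃ m, ∀ y, w * L a y + (1 - w) * L b y = w * L a m + (1 - w) * L b m + L m y := by
  obtain ⟨tc, yc, -, hyc, hdec⟩ := h
  refine ⟨tc (twoPointLaw a b w hw), fun y => ?_⟩
  have hval : ValidPredictionLaw L (pointLaw y) := fun t => integrable_dirac (by simp)
  have hcenter : yc (pointLaw y) = y := by
    have h1 := hyc _ hval y
    rw [integral_pointLaw, integral_pointLaw, (hL.eq_zero_iff y y).2 rfl] at h1
    exact (hL.eq_zero_iff _ _).1 (le_antisymm h1 (hL.nonneg _ _))
  have h2 := (hdec (twoPointLaw a b w hw) (pointLaw y)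
    (fun y => integrable_twoPointLaw _ hw) hval).2
  rw [twoPointLaw_prod_pointLaw, integral_twoPointLaw, integral_twoPointLaw, integral_pointLaw,
    hcenter, (hL.eq_zero_iff y y).2 rfl, add_zero] at h2
  exact h2

/-- For a symmetric loss the noise of the two-point law is `w (1 - w) L a b`, as evaluation of the
decomposition at `a` and at `b` shows. -/
theorem HasCleanDecomposition.exists_barycenter {L : α → α → ℝ} (hL : IsLoss L)
    (hsymm : ∀ t y, L t y = L y t) (h : HasCleanDecomposition L) (a b : α) {w : ℝ}
    (hw : w ∈ Set.Icc (0 : ℝ) 1) :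
    ∃ m, w * L a m + (1 - w) * L b m = w * (1 - w) * L a b ∧
      ∀ y, w * L a y + (1 - w) * L b y = w * (1 - w) * L a b + L m y := by
  obtain ⟨m, hm⟩ := h.exists_center hL a b hw
  have ha := hm a
  have hb := hm b
  rw [(hL.eq_zero_iff a a).2 rfl, hsymm b a, hsymm m a] at ha
  rw [(hL.eq_zero_iff b b).2 rfl, hsymm m b] at hb
  have hV : w * L a m + (1 - w) * L b m = w * (1 - w) * L a b := by
    linear_combination (-w / 2) * ha - ((1 - w) / 2) * hb
  exact ⟨m, hV, fun y => by rw [hm y, hV]⟩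

/-- For weights `1 / 2` the noise is `L a b / 4`, while the triangle inequality makes it at least
`L a b / 2`. All laws involved are finitely supported, so that `L` may be nonmeasurable. -/
theorem IsMetricLoss.not_hasCleanDecomposition [Nontrivial α] {L : α → α → ℝ}
    (hL : IsMetricLoss L) : ¬ HasCleanDecomposition L := by
  intro h
  obtain ⟨a, b, hab⟩ := exists_pair_ne α
  obtain ⟨m, hm, -⟩ := h.exists_barycenter hL.toIsLoss hL.symm a b
    (w := 1 / 2) (by norm_num)
  have h1 := hL.triangle a m b
  rw [hL.symm m b] at h1
  have h2 : 0 < L a b := (hL.nonneg a b).lt_of_ne fun h0 => hab ((hL.eq_zero_iff a b).1 h0.symm)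
  linarith

end TwoPointLaws

theorem isMetricLoss_zeroOneLoss {α : Type*} : IsMetricLoss (zeroOneLoss : α → α → ℝ) where
  nonneg t y := by unfold zeroOneLoss; split_ifs <;> norm_num
  eq_zero_iff t y := by simp [zeroOneLoss]
  symm t y := by
    unfold zeroOneLoss
    by_cases h : t = y <;> simp [h, Ne.symm]
  triangle t s y := by
    unfold zeroOneLoss
    by_cases h1 : t = s <;> by_cases h2 : s = y <;> by_cases h3 : t = y <;> simp_all

theorem isMetricLoss_manhattanLoss {d : ℕ} {Y : Set (EuclideanSpace ℝ (Fin d))} :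
    IsMetricLoss (manhattanLoss : Y → Y → ℝ) where
  nonneg t y := Finset.sum_nonneg fun _ _ => abs_nonneg _
  eq_zero_iff t y := by
    unfold manhattanLoss
    rw [Finset.sum_eq_zero_iff_of_nonneg fun _ _ => abs_nonneg _]
    simp only [Finset.mem_univ, abs_eq_zero, forall_const, sub_eq_zero]
    exact ⟨fun h => Subtype.ext (PiLp.ext h), fun h i => by rw [h]⟩
  symm t y := Finset.sum_congr rfl fun _ _ => abs_sub_comm _ _
  triangle t s y := by
    unfold manhattanLoss
    rw [← Finset.sum_add_distrib]
    exact Finset.sum_le_sum fun _ _ => abs_sub_le _ _ _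

/-! ### Hilbert space embedding of a loss with barycenters -/

section Kernel

variable {α : Type*}

/-- Every two points have all their barycenters with respect to `L`: the weighted mean of
`L a ·` and `L b ·` is `L m ·` up to a constant. -/
def HasBarycenters (L : α → α → ℝ) : Prop :=
  ∀ a b : α, ∀ w ∈ Set.Icc (0 : ℝ) 1, ∃ m, ∀ y,
    w * L a y + (1 - w) * L b y = w * (1 - w) * L a b + L m y

/-- The candidate inner product of the displacements of `t` and `y` from `o`, if `L` is a squared
distance. -/
noncomputable def polarKernel (L : α → α → ℝ) (o t y : α) : ℝ := (L t o + L y o - L t y) / 2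

/-- Nonnegative combinations of two kernel sections are multiples of a kernel section. -/
theorem HasBarycenters.exists_add_polarKernel {L : α → α → ℝ} (hb : HasBarycenters L) (o a b : α)
    {p q : ℝ} (hp : 0 ≤ p) (hq : 0 ≤ q) :
    ∃ m, ∀ y, p * polarKernel L o a y + q * polarKernel L o b y =
      (p + q) * polarKernel L o m y := by
  rcases (add_nonneg hp hq).eq_or_lt with h0 | hpos
  · have hp0 : p = 0 := by linarith
    have hq0 : q = 0 := by linarith
    exact ⟨a, fun y => by simp [hp0, hq0]⟩
  · obtain ⟨m, hm⟩ := hb a b (p / (p + q))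
      ⟨by positivity, (div_le_one hpos).2 (by linarith)⟩
    refine ⟨m, fun y => ?_⟩
    have e : 1 - p / (p + q) = q / (p + q) := by field_simp; ring
    have ho := hm o
    have hy := hm y
    rw [e] at ho hy
    unfold polarKernel
    have e1 : p = (p + q) * (p / (p + q)) := by field_simp
    have e2 : q = (p + q) * (q / (p + q)) := by field_simp
    have e3 : p / (p + q) + q / (p + q) = 1 := by field_simp
    generalize p / (p + q) = u at *
    generalize q / (p + q) = v at *
    generalize hs : p + q = s at *
    rw [e1, e2]
    linear_combination (s / 2) * ho - (s / 2) * hy + (s * L y o / 2) * e3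

/-- A linear combination of kernel sections is a nonnegative multiple of a difference of two
kernel sections: this reduces positivity of the kernel to nonnegativity of `L`. -/
theorem HasBarycenters.exists_sum_polarKernel {L : α → α → ℝ} (hL : IsLoss L)
    (hsymm : ∀ t y, L t y = L y t) (hb : HasBarycenters L) (o : α) (c : α →₀ ℝ) :
    ∃ (M : ℝ) (a b : α), 0 ≤ M ∧ ∀ y,
      (c.sum fun x r => r * polarKernel L o x y) =
        M * (polarKernel L o a y - polarKernel L o b y) := by
  have ho : ∀ y, polarKernel L o o y = 0 := fun y => by
    simp [polarKernel, (hL.eq_zero_iff o o).2 rfl, hsymm y o]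
  induction c using Finsupp.induction with
  | zero => exact ⟨0, o, o, le_rfl, fun y => by simp⟩
  | single_add x r c hx hr ih =>
    obtain ⟨M, a, b, hM0, hM⟩ := ih
    have hsum : ∀ y, ((Finsupp.single x r + c).sum fun x r => r * polarKernel L o x y) =
        r * polarKernel L o x y + M * (polarKernel L o a y - polarKernel L o b y) := by
      intro y
      rw [Finsupp.sum_add_index' (by simp) (by intros; ring),
        Finsupp.sum_single_index (by simp), hM y]
    -- the section at `o` vanishes and serves as the second point, or the first if `r < 0`
    obtain ⟨r', x₁, x₂, hr', hx'⟩ : ∃ (r' : ℝ) (x₁ x₂ : α), 0 ≤ r' ∧ ∀ y,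
        r * polarKernel L o x y = r' * (polarKernel L o x₁ y - polarKernel L o x₂ y) := by
      rcases le_total 0 r with h | h
      · exact ⟨r, x, o, h, fun y => by rw [ho]; ring⟩
      · exact ⟨-r, o, x, by linarith, fun y => by rw [ho]; ring⟩
    obtain ⟨a', ha'⟩ := hb.exists_add_polarKernel o x₁ a hr' hM0
    obtain ⟨b', hb'⟩ := hb.exists_add_polarKernel o x₂ b hr' hM0
    refine ⟨r' + M, a', b', by linarith, fun y => ?_⟩
    rw [hsum, hx']
    linear_combination ha' y - hb' y

theorem HasBarycenters.sum_sum_polarKernel_nonneg {L : α → α → ℝ} (hL : IsLoss L)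
    (hsymm : ∀ t y, L t y = L y t) (hb : HasBarycenters L) (o : α) (c : α →₀ ℝ) :
    0 ≤ c.sum fun x r => c.sum fun y s => r * s * polarKernel L o x y := by
  obtain ⟨M, a, b, -, hM⟩ := hb.exists_sum_polarKernel hL hsymm o c
  have hk : ∀ t y, polarKernel L o t y = polarKernel L o y t := fun t y => by
    simp [polarKernel, hsymm t y, add_comm]
  have hsum : (c.sum fun x r => c.sum fun y s => r * s * polarKernel L o x y) =
      M * ((c.sum fun y s => s * polarKernel L o y a) -
        c.sum fun y s => s * polarKernel L o y b) := by
    rw [Finsupp.sum_comm]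
    simp only [Finsupp.sum, ← Finset.sum_sub_distrib, Finset.mul_sum]
    refine Finset.sum_congr rfl fun y _ => ?_
    have h := hM y
    simp only [Finsupp.sum] at h
    have h' : ∑ x ∈ c.support, c x * c y * polarKernel L o x y =
        c y * ∑ x ∈ c.support, c x * polarKernel L o x y := by
      rw [Finset.mul_sum]
      exact Finset.sum_congr rfl fun x _ => by ring
    rw [h', h, hk y a, hk y b]
    ring
  rw [hsum, hM a, hM b]
  have h : M * (M * (polarKernel L o a a - polarKernel L o b a) -
      M * (polarKernel L o a b - polarKernel L o b b)) = M ^ 2 * L a b := by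
    simp only [polarKernel, (hL.eq_zero_iff a a).2 rfl, (hL.eq_zero_iff b b).2 rfl, hsymm b a]
    ring
  rw [h]
  exact mul_nonneg (sq_nonneg _) (hL.nonneg _ _)

universe u in
/-- A symmetric loss with barycenters is a squared Hilbert space distance: the embedding sends a
point to its section in the reproducing kernel Hilbert space of the polar kernel. -/
theorem HasBarycenters.exists_isometric {α : Type u} {L : α → α → ℝ} (hL : IsLoss L)
    (hsymm : ∀ t y, L t y = L y t) (hb : HasBarycenters L) (o : α) :
    ∃ (H : Type u) (_ : NormedAddCommGroup H) (_ : InnerProductSpace ℝ H) (φ : α → H),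
      ∀ t y, L t y = ‖φ t - φ y‖ ^ 2 := by
  let K : Matrix α α (ℝ →L[ℝ] ℝ) :=
    Matrix.of fun x y => polarKernel L o x y • ContinuousLinearMap.id ℝ ℝ
  have hKh : K.IsHermitian := by
    ext1 x y
    change star (polarKernel L o y x • (1 : ℝ →L[ℝ] ℝ)) = polarKernel L o x y • (1 : ℝ →L[ℝ] ℝ)
    rw [star_smul, star_one]
    simp [polarKernel, hsymm x y, add_comm]
  have hK : K.PosSemidef := by
    have htfae := (RKHS.posSemidef_tfae (K := K)).out 0 2
    refine htfae.2 ⟨hKh, fun c => ?_⟩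
    have h := hb.sum_sum_polarKernel_nonneg hL hsymm o c
    refine h.trans_eq ?_
    simp only [K, Finsupp.sum, RCLike.re_to_real]
    rw [Finset.sum_comm]
    refine Finset.sum_congr rfl fun x _ => Finset.sum_congr rfl fun y _ => ?_
    simp
    ring
  have : Fact K.PosSemidef := ⟨hK⟩
  refine ⟨RKHS.OfKernel K, inferInstance, inferInstance,
    fun x => RKHS.kerFun (RKHS.OfKernel K) x (1 : ℝ), fun t y => ?_⟩
  have hin : ∀ x y, inner ℝ (RKHS.kerFun (RKHS.OfKernel K) x (1 : ℝ))
      (RKHS.kerFun (RKHS.OfKernel K) y (1 : ℝ)) = polarKernel L o x y := by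
    intro x y
    rw [← RKHS.kernel_inner, RKHS.OfKernel.kernel_ofKernel]
    simp [K, polarKernel, hsymm x y, add_comm]
  rw [@norm_sub_sq_real, ← real_inner_self_eq_norm_sq, ← real_inner_self_eq_norm_sq, hin, hin, hin]
  simp only [polarKernel, (hL.eq_zero_iff t t).2 rfl, (hL.eq_zero_iff y y).2 rfl]
  ring

end Kernel

theorem continuous_of_norm_sub_sq {α H : Type*} [TopologicalSpace α] [NormedAddCommGroup H]
    {L : α → α → ℝ} (hcont : Continuous fun p : α × α => L p.1 p.2) {φ : α → H}
    (hφ : ∀ t y, L t y = ‖φ t - φ y‖ ^ 2) : Continuous φ := by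
  refine continuous_iff_continuousAt.2 fun y => tendsto_iff_norm_sub_tendsto_zero.2 ?_
  have h1 : Filter.Tendsto (fun x => L x y) (nhds y) (nhds (L y y)) :=
    (hcont.comp (continuous_id.prodMk continuous_const)).tendsto y
  simpa [hφ] using h1.sqrt

/-- The squared distance from `φ m` to `p • φ a + q • φ b` is an affine combination of values of
`L`, and vanishes when `m` is the barycenter of `a` and `b`. -/
theorem HasBarycenters.convex_range {α H : Type*} [NormedAddCommGroup H] [InnerProductSpace ℝ H]
    {L : α → α → ℝ} (hb : HasBarycenters L) {φ : α → H} (hφ : ∀ t y, L t y = ‖φ t - φ y‖ ^ 2) :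
    Convex ℝ (Set.range φ) := by
  rintro _ ⟨a, rfl⟩ _ ⟨b, rfl⟩ p q hp hq hpq
  obtain ⟨m, hm⟩ := hb a b p ⟨hp, by linarith⟩
  obtain rfl : q = 1 - p := by linarith
  refine ⟨m, ?_⟩
  have h := hm m
  simp only [hφ, sub_self, norm_zero] at h
  have key : ‖φ m - (p • φ a + (1 - p) • φ b)‖ ^ 2 =
      p * ‖φ a - φ m‖ ^ 2 + (1 - p) * ‖φ b - φ m‖ ^ 2 - p * (1 - p) * ‖φ a - φ b‖ ^ 2 := by
    have e1 : φ m - (p • φ a + (1 - p) • φ b) = -(p • (φ a - φ m) + (1 - p) • (φ b - φ m)) := by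
      module
    have e2 : φ a - φ b = (φ a - φ m) - (φ b - φ m) := by abel
    rw [e1, e2]
    generalize φ a - φ m = u
    generalize φ b - φ m = v
    rw [norm_neg, @norm_add_sq_real, @norm_sub_sq_real, norm_smul, norm_smul,
      inner_smul_left, inner_smul_right, mul_pow, mul_pow, Real.norm_eq_abs, Real.norm_eq_abs,
      sq_abs, sq_abs]
    simp only [RCLike.conj_to_real]
    ring
  have h0 : ‖φ m - (p • φ a + (1 - p) • φ b)‖ ^ 2 = 0 := by rw [key]; linarith
  exact sub_eq_zero.1 (norm_eq_zero.1 (pow_eq_zero_iff two_ne_zero |>.1 h0))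

/-! ### The dimension of the embedded range -/

open Topology in
/-- Invariance of dimension for a continuous bijection `φ` from a σ-compact set onto a convex set.
The image contains the simplex with vertices `φ o` and `φ (z i)`. By Baire, the image of one of the
compact pieces of `Y` contains a ball of this simplex, and on this image the inverse of `φ` is
continuous. -/
theorem card_le_finrank_of_convex_range {F H ι : Type*} [NormedAddCommGroup F] [NormedSpace ℝ F]
    [FiniteDimensional ℝ F] [NormedAddCommGroup H] [NormedSpace ℝ H] [Fintype ι]
    {Y : Set F} (hY : IsSigmaCompact Y) {φ : Y → H} (hφ : Continuous φ)
    (hinj : Function.Injective φ) (hconv : Convex ℝ (Set.range φ)) (o : Y) (z : ι → Y)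
    (hz : LinearIndependent ℝ fun i => φ (z i) - φ o) :
    Fintype.card ι ≤ Module.finrank ℝ F := by
  by_contra! hlt
  have : SigmaCompactSpace Y := isSigmaCompact_iff_sigmaCompactSpace.1 hY
  let A : EuclideanSpace ℝ ι → H := fun s => φ o + ∑ i, s i • (φ (z i) - φ o)
  have hA : Continuous A := by fun_prop
  have hAinj : Function.Injective A := by
    intro s t hst
    have h1 : ∑ i, (s i - t i) • (φ (z i) - φ o) = 0 := by
      simp_rw [sub_smul, Finset.sum_sub_distrib]
      exact sub_eq_zero.2 (add_left_cancel hst)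
    ext i
    exact sub_eq_zero.1 (Fintype.linearIndependent_iff.1 hz _ h1 i)
  -- the interior of the simplex in barycentric coordinates, the weight of `φ o` being omitted
  let O : Set (EuclideanSpace ℝ ι) := {s | (∀ i, 0 < s i) ∧ ∑ i, s i < 1}
  have hO : IsOpen O := by
    refine IsOpen.inter ?_ (isOpen_lt
      (by fun_prop : Continuous fun s : EuclideanSpace ℝ ι => ∑ i, s i) continuous_const)
    have : {s : EuclideanSpace ℝ ι | ∀ i, 0 < s i} = ⋂ i, {s | 0 < s i} := by ext; simp
    change IsOpen {s : EuclideanSpace ℝ ι | ∀ i, 0 < s i}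
    rw [this]
    exact isOpen_iInter_of_finite fun i => isOpen_lt continuous_const
      (by fun_prop : Continuous fun s : EuclideanSpace ℝ ι => s i)
  have hOne : O.Nonempty := by
    refine ⟨WithLp.toLp 2 fun _ => ((Fintype.card ι : ℝ) + 1)⁻¹, fun i => ?_, ?_⟩
    · simp only
      positivity
    · simp only [Finset.sum_const, Finset.card_univ, nsmul_eq_mul]
      rw [← div_eq_mul_inv, div_lt_one (by positivity)]
      linarith
  have hAO : ∀ s ∈ O, A s ∈ Set.range φ := by
    rintro s ⟨hs0, hs1⟩
    have h := hconv.sum_mem (t := Finset.univ) (w := fun i : Option ι => i.elim (1 - ∑ i, s i) s)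
      (z := fun i : Option ι => φ (i.elim o z)) ?_ ?_ (fun i _ => ⟨_, rfl⟩)
    · convert h using 1
      simp only [A, Fintype.sum_option, Option.elim, smul_sub, Finset.sum_sub_distrib, sub_smul,
        one_smul, Finset.sum_smul]
      abel
    · rintro (_ | i) _
      · simp only [Option.elim]; linarith
      · exact (hs0 i).le
    · simp [Fintype.sum_option]
  let C : ℕ → Set (EuclideanSpace ℝ ι) := fun n => A ⁻¹' (φ '' compactCovering Y n)
  have hC : ∀ n, IsClosed (C n) := fun n =>
    (((isCompact_compactCovering Y n).image hφ).isClosed).preimage hA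
  obtain ⟨n, hn⟩ : ∃ n, (interior (C n)).Nonempty := by
    by_contra! hempty
    refine not_isMeagre_of_isOpen hO hOne ((isMeagre_iUnion fun n =>
      ((hC n).isNowhereDense_iff.2 (hempty n)).isMeagre).mono ?_)
    intro s hs
    obtain ⟨y, hy⟩ := hAO s hs
    have hy' : y ∈ ⋃ n, compactCovering Y n := by simp [iUnion_compactCovering]
    obtain ⟨n, hn⟩ := Set.mem_iUnion.1 hy'
    exact Set.mem_iUnion.2 ⟨n, y, hn, hy⟩
  obtain ⟨s₀, hs₀⟩ := hn
  obtain ⟨r, hr, hball⟩ := Metric.nhds_basis_closedBall.mem_iff.1 (mem_interior_iff_mem_nhds.1 hs₀)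
  have hmem : ∀ x : Metric.closedBall (0 : EuclideanSpace ℝ ι) 1,
      ∃ y : compactCovering Y n, φ y = A (s₀ + r • x.1) := by
    rintro ⟨x, hx⟩
    have hx' : s₀ + r • x ∈ Metric.closedBall s₀ r := by
      rw [mem_closedBall_zero_iff] at hx
      rw [mem_closedBall_iff_norm, add_sub_cancel_left, norm_smul, Real.norm_of_nonneg hr.le]
      exact mul_le_of_le_one_right hr.le hx
    obtain ⟨y, hy, hyA⟩ := hball hx'
    exact ⟨⟨y, hy⟩, hyA⟩
  choose q hq using hmem
  have : CompactSpace (compactCovering Y n) :=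
    isCompact_iff_compactSpace.1 (isCompact_compactCovering Y n)
  have hemb : IsClosedEmbedding fun y : compactCovering Y n => φ y :=
    (hφ.comp continuous_subtype_val).isClosedEmbedding (hinj.comp Subtype.val_injective)
  have hqc : Continuous q := by
    rw [hemb.isInducing.continuous_iff]
    have : (fun y : compactCovering Y n => φ y) ∘ q = fun x => A (s₀ + r • x.1) := funext hq
    rw [this]
    fun_prop
  have hqinj : Function.Injective q := by
    intro x y hxy
    have h1 : A (s₀ + r • x.1) = A (s₀ + r • y.1) := by rw [← hq, ← hq, hxy]
    exact Subtype.ext (smul_right_injective _ hr.ne' (add_left_cancel (hAinj h1)))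
  refine not_injective_of_continuous_closedBall (E := EuclideanSpace ℝ ι) (F := F)
    (by simpa using hlt)
    (continuous_subtype_val.comp (continuous_subtype_val.comp hqc)) ?_
  exact Subtype.val_injective.comp (Subtype.val_injective.comp hqinj)

theorem finrank_span_le_of_convex_range {F H : Type*} [NormedAddCommGroup F] [NormedSpace ℝ F]
    [FiniteDimensional ℝ F] [NormedAddCommGroup H] [NormedSpace ℝ H]
    {Y : Set F} (hY : IsSigmaCompact Y) {φ : Y → H} (hφ : Continuous φ)
    (hinj : Function.Injective φ) (hconv : Convex ℝ (Set.range φ)) (o : Y) :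
    FiniteDimensional ℝ (Submodule.span ℝ (Set.range fun y => φ y - φ o)) ∧
      Module.finrank ℝ (Submodule.span ℝ (Set.range fun y => φ y - φ o)) ≤
        Module.finrank ℝ F := by
  obtain ⟨b, hbs, hspan, hli⟩ := exists_linearIndependent ℝ (Set.range fun y => φ y - φ o)
  have hcard : ∀ s : Finset H, (s : Set H) ⊆ b → s.card ≤ Module.finrank ℝ F := by
    intro s hs
    have hs' : ∀ x : s, ∃ y, φ y - φ o = x := fun x => hbs (hs x.2)
    choose z hz using hs'
    have h := card_le_finrank_of_convex_range hY hφ hinj hconv o z (by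
      simp_rw [hz]
      exact hli.comp (fun x : s => ⟨x.1, hs x.2⟩) fun x y h => Subtype.ext (by simpa using h))
    simpa using h
  have hfin : b.Finite := by
    by_contra hinf
    obtain ⟨s, hs, hsc⟩ := Set.Infinite.exists_subset_card_eq hinf (Module.finrank ℝ F + 1)
    have := hcard s hs
    omega
  rw [← hspan]
  have := hfin.fintype
  refine ⟨FiniteDimensional.span_of_finite ℝ hfin, ?_⟩
  rw [finrank_span_set_eq_card hli]
  exact hcard b.toFinset (by simp)

theorem exists_linearIsometry_euclideanSpace {W : Type*} [NormedAddCommGroup W]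
    [InnerProductSpace ℝ W] [FiniteDimensional ℝ W] {d : ℕ} (hd : Module.finrank ℝ W ≤ d) :
    Nonempty (W →ₗᵢ[ℝ] EuclideanSpace ℝ (Fin d)) := by
  let b := stdOrthonormalBasis ℝ W
  let e := EuclideanSpace.basisFun (Fin d) ℝ
  let f : W →ₗ[ℝ] EuclideanSpace ℝ (Fin d) :=
    b.toBasis.constr ℝ fun i => e (Fin.castLE hd i)
  refine ⟨f.isometryOfOrthonormal (v := b.toBasis) (by simp [b.orthonormal]) ?_⟩
  have : f ∘ b.toBasis = fun i => e (Fin.castLE hd i) := by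
    ext1 i
    exact b.toBasis.constr_basis ℝ _ i
  rw [this]
  exact e.orthonormal.comp _ (Fin.castLE_injective hd)

/-- The coordinates are chosen orthonormal, so that `K` is the identity matrix. -/
theorem exists_mahalanobisLoss_of_hasBarycenters {d : ℕ} {Y : Set (EuclideanSpace ℝ (Fin d))}
    (hY : IsSigmaCompact Y) {L : Y → Y → ℝ} (hcont : Continuous fun p : Y × Y => L p.1 p.2)
    (hL : IsLoss L) (hsymm : ∀ t y, L t y = L y t) (hb : HasBarycenters L) :
    ∃ (g : Y → Fin d → ℝ) (K : Matrix (Fin d) (Fin d) ℝ),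
      Function.Injective g ∧ Convex ℝ (Set.range g) ∧ K.PosDef ∧
        ∀ t y, L t y = mahalanobisLoss g K t y := by
  rcases isEmpty_or_nonempty Y with hempty | ⟨⟨o⟩⟩
  · exact ⟨fun _ => 0, 1, fun x => isEmptyElim x,
      by rw [Set.range_eq_empty]; exact convex_empty, Matrix.PosDef.one,
      fun t => isEmptyElim t⟩
  obtain ⟨H, _, _, φ, hφ⟩ := hb.exists_isometric hL hsymm o
  have hφc : Continuous φ := continuous_of_norm_sub_sq hcont hφ
  have hφi : Function.Injective φ := fun t y h =>
    (hL.eq_zero_iff t y).1 (by rw [hφ, h, sub_self, norm_zero]; norm_num)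
  have hφr := hb.convex_range hφ
  obtain ⟨hfd, hdim⟩ := finrank_span_le_of_convex_range hY hφc hφi hφr o
  rw [finrank_euclideanSpace_fin] at hdim
  set W := Submodule.span ℝ (Set.range fun y => φ y - φ o) with hW
  obtain ⟨T⟩ := exists_linearIsometry_euclideanSpace hdim
  have hmem : ∀ y, φ y - φ o ∈ W := fun y => Submodule.subset_span ⟨y, rfl⟩
  let w : Y → W := fun y => ⟨φ y - φ o, hmem y⟩
  have hdist : ∀ t y, ‖T (w t) - T (w y)‖ ^ 2 = L t y := by
    intro t y
    rw [← map_sub, T.norm_map, hφ]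
    simp [w]
  refine ⟨fun y => (T (w y)).ofLp, 1, fun t y h => ?_, ?_, Matrix.PosDef.one, fun t y => ?_⟩
  · refine (hL.eq_zero_iff t y).1 ?_
    rw [← hdist, PiLp.ext (congrFun h), sub_self, norm_zero]
    norm_num
  · rintro _ ⟨a, rfl⟩ _ ⟨b, rfl⟩ p q hp hq hpq
    obtain ⟨m, hm⟩ := hφr ⟨a, rfl⟩ ⟨b, rfl⟩ hp hq hpq
    refine ⟨m, ?_⟩
    have hw : w m = p • w a + q • w b := by
      ext
      simp only [w, Submodule.coe_add, Submodule.coe_smul, hm]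
      have : φ o = (p + q) • φ o := by rw [hpq, one_smul]
      conv_lhs => rw [this]
      module
    simp [hw]
  · rw [← hdist, EuclideanSpace.norm_sq_eq]
    simp [mahalanobisLoss, dotProduct, sq]

/-! ### Means of variables with values in a convex set -/

/-- A point outside a convex set in finite dimension, closed or not, is weakly separated from it by
a nonzero functional if the set has interior points; if not, a nonzero functional is constant on
the set. -/
theorem Convex.exists_dual_ne_zero {E : Type*} [NormedAddCommGroup E] [NormedSpace ℝ E]
    [FiniteDimensional ℝ E] {C : Set E} (hC : Convex ℝ C) (hne : C.Nonempty) {m : E} (hm : m ∉ C) :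
    ∃ f : StrongDual ℝ E, f ≠ 0 ∧ ((∀ a ∈ C, f a ≤ f m) ∨ ∃ c, ∀ a ∈ C, f a = c) := by
  by_cases hint : (interior C).Nonempty
  · obtain ⟨f, hf, h⟩ := geometric_hahn_banach_of_nonempty_interior_point hC
      (fun h => hm (interior_subset h)) hint
    exact ⟨f, hf, Or.inl h⟩
  · rw [hC.interior_nonempty_iff_affineSpan_eq_top] at hint
    have hdir : vectorSpan ℝ C < ⊤ := by
      refine lt_top_iff_ne_top.2 fun h => hint ?_
      exact (AffineSubspace.affineSpan_eq_top_iff_vectorSpan_eq_top_of_nonempty ℝ E E hne).2 h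
    obtain ⟨f, hf, hker⟩ := Submodule.exists_le_ker_of_lt_top _ hdir
    obtain ⟨c, hc⟩ := hne
    refine ⟨LinearMap.toContinuousLinearMap f, by simpa using hf, Or.inr ⟨f c, fun a ha => ?_⟩⟩
    have h := hker (vsub_mem_vectorSpan ℝ ha hc)
    rw [LinearMap.mem_ker, vsub_eq_sub, map_sub, sub_eq_zero] at h
    simpa using h

universe u in
/-- The mean of an integrable variable with values in a convex set of a finite-dimensional space
lies in this set, which need not be closed. Otherwise a separating functional equals its mean almost
surely, so that the variable lives in a hyperplane through the mean, and induction on the dimension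
applies. -/
theorem Convex.integral_mem_of_finrank {Ω : Type*} [MeasurableSpace Ω] {μ : Measure Ω}
    [IsProbabilityMeasure μ] (n : ℕ) : ∀ {E : Type u} [NormedAddCommGroup E]
    [InnerProductSpace ℝ E] [FiniteDimensional ℝ E], Module.finrank ℝ E = n →
    ∀ {C : Set E}, Convex ℝ C → ∀ {φ : Ω → E}, Integrable φ μ → (∀ᵐ ω ∂μ, φ ω ∈ C) →
    ∫ ω, φ ω ∂μ ∈ C := by
  induction n using Nat.strong_induction_on with
  | _ n ih =>
    intro E _ _ _ hn C hC φ hφ hmem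
    by_contra hm
    set m := ∫ ω, φ ω ∂μ with hmdef
    obtain ⟨ω₀, hω₀⟩ := hmem.exists
    obtain ⟨f, hf, hsep⟩ := hC.exists_dual_ne_zero ⟨_, hω₀⟩ hm
    have hfint : ∫ ω, f (φ ω) ∂μ = f m := f.integral_comp_comm hφ
    have hfφ : Integrable (fun ω => f (φ ω)) μ := f.integrable_comp hφ
    -- the functional takes its mean value almost surely
    have hae : ∀ᵐ ω ∂μ, f (φ ω) = f m := by
      rcases hsep with hle | ⟨c, hc⟩
      · have h0 : ∫ ω, (f m - f (φ ω)) ∂μ = 0 := by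
          rw [integral_sub (integrable_const _) hfφ, hfint]
          simp
        have hnn : 0 ≤ᵐ[μ] fun ω => f m - f (φ ω) := by
          filter_upwards [hmem] with ω hω
          exact sub_nonneg.2 (hle _ hω)
        filter_upwards [(integral_eq_zero_iff_of_nonneg_ae hnn
          ((integrable_const _).sub hfφ)).1 h0] with ω hω
        exact (sub_eq_zero.1 hω).symm
      · have hcae : ∀ᵐ ω ∂μ, f (φ ω) = c := hmem.mono fun ω hω => hc _ hω
        have : f m = c := by
          rw [← hfint, integral_congr_ae hcae]
          simp
        rwa [this]
    -- the deviation from the mean lives in the kernel of the functional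
    let W := LinearMap.ker (f : E →ₗ[ℝ] ℝ)
    have hW : Module.finrank ℝ W < n := by
      rw [← hn]
      refine Submodule.finrank_lt fun htop => hf ?_
      ext x
      exact Submodule.eq_top_iff'.1 htop x
    let ψ : Ω → W := fun ω => W.orthogonalProjectionOnto (φ ω - m)
    have hψ : ∀ᵐ ω ∂μ, (ψ ω : E) = φ ω - m := by
      filter_upwards [hae] with ω hω
      have : φ ω - m ∈ W := by
        change f (φ ω - m) = 0
        rw [map_sub, hω, sub_self]
      exact congrArg Subtype.val (Submodule.orthogonalProjectionOnto_mem_subspace_eq_self ⟨_, this⟩)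
    have hsub : Integrable (fun ω => φ ω - m) μ := hφ.sub (integrable_const _)
    have hψint : ∫ ω, ψ ω ∂μ = 0 := by
      have h := W.orthogonalProjectionOnto.integral_comp_comm hsub
      rw [integral_sub hφ (integrable_const _)] at h
      rw [← hmdef, integral_const, probReal_univ, one_smul, sub_self, map_zero] at h
      exact h
    have hC' : Convex ℝ {v : W | (v : E) + m ∈ C} := by
      intro v hv w hw a b ha hb hab
      have h := hC hv hw ha hb hab
      have e : a • ((v : E) + m) + b • ((w : E) + m) = ((a • v + b • w : W) : E) + m := by
        have : m = (a + b) • m := by rw [hab, one_smul]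
        conv_rhs => rw [this]
        simp only [Submodule.coe_add, Submodule.coe_smul]
        module
      rwa [e] at h
    have h := ih _ hW rfl hC' (W.orthogonalProjectionOnto.integrable_comp hsub) (by
      filter_upwards [hψ, hmem] with ω h1 h2
      change ((ψ ω : W) : E) + m ∈ C
      rwa [h1, sub_add_cancel])
    change (((∫ ω, ψ ω ∂μ : W) : W) : E) + m ∈ C at h
    rw [hψint] at h
    exact hm (by simpa using h)

/-! ### Decomposition of squared distances -/

theorem integrable_of_integrable_norm_sub_sq {Ω E : Type*} [MeasurableSpace Ω] {μ : Measure Ω}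
    [IsProbabilityMeasure μ] [NormedAddCommGroup E] {φ : Ω → E} (hφ : AEStronglyMeasurable φ μ)
    {c : E} (hc : Integrable (fun ω => ‖φ ω - c‖ ^ 2) μ) : Integrable φ μ := by
  refine (hc.add (integrable_const (1 + ‖c‖))).mono' hφ (Filter.Eventually.of_forall fun ω => ?_)
  have h : ‖φ ω‖ ≤ ‖φ ω - c‖ + ‖c‖ := by
    simpa using norm_add_le (φ ω - c) c
  simp only [Pi.add_apply]
  nlinarith [sq_nonneg (‖φ ω - c‖ - 1)]

theorem norm_sub_sq_le_two_mul {E : Type*} [NormedAddCommGroup E] (x y c : E) :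
    ‖x - y‖ ^ 2 ≤ 2 * ‖x - c‖ ^ 2 + 2 * ‖y - c‖ ^ 2 := by
  have h := norm_sub_le (x - c) (y - c)
  rw [sub_sub_sub_cancel_right] at h
  nlinarith [sq_nonneg (‖x - c‖ - ‖y - c‖), norm_nonneg (x - y)]

/-- The parallel axis identity. -/
theorem integral_norm_sub_sq {Ω E : Type*} [MeasurableSpace Ω] {μ : Measure Ω}
    [IsProbabilityMeasure μ] [NormedAddCommGroup E] [InnerProductSpace ℝ E] [CompleteSpace E]
    {φ : Ω → E} (hφ : AEStronglyMeasurable φ μ)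
    {c : E} (hc : Integrable (fun ω => ‖φ ω - c‖ ^ 2) μ) (z : E) :
    ∫ ω, ‖φ ω - z‖ ^ 2 ∂μ = ∫ ω, ‖φ ω - ∫ η, φ η ∂μ‖ ^ 2 ∂μ + ‖∫ η, φ η ∂μ - z‖ ^ 2 := by
  have hint := integrable_of_integrable_norm_sub_sq hφ hc
  set m := ∫ η, φ η ∂μ with hm
  have hm2 : Integrable (fun ω => ‖φ ω - m‖ ^ 2) μ := by
    refine ((hc.const_mul 2).add (integrable_const (2 * ‖m - c‖ ^ 2))).mono'
      ((hφ.sub aestronglyMeasurable_const).norm.pow 2) (Filter.Eventually.of_forall fun ω => ?_)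
    rw [Real.norm_of_nonneg (by positivity)]
    exact norm_sub_sq_le_two_mul _ _ _
  have hsub : Integrable (fun ω => φ ω - m) μ := hint.sub (integrable_const _)
  have hin : Integrable (fun ω => inner ℝ (m - z) (φ ω - m)) μ := hsub.const_inner _
  have hin0 : ∫ ω, inner ℝ (m - z) (φ ω - m) ∂μ = 0 := by
    rw [integral_inner hsub, integral_sub hint (integrable_const _), ← hm]
    simp
  have hexp : ∀ ω, ‖φ ω - z‖ ^ 2 =
      ‖φ ω - m‖ ^ 2 + 2 * inner ℝ (m - z) (φ ω - m) + ‖m - z‖ ^ 2 := by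
    intro ω
    have : φ ω - z = (φ ω - m) + (m - z) := by abel
    rw [this, @norm_add_sq_real, real_inner_comm]
  simp_rw [hexp]
  rw [integral_add (f := fun ω => ‖φ ω - m‖ ^ 2 + 2 * inner ℝ (m - z) (φ ω - m))
      (hm2.add (hin.const_mul 2)) (integrable_const _), integral_add hm2 (hin.const_mul 2),
    integral_const_mul, hin0]
  simp

/-- A squared distance between images in a convex set: the central point of a law is the preimage of
its mean, for labels and predictions alike. -/
theorem hasCleanDecomposition_of_norm_sub_sq {α E : Type*} [MeasurableSpace α]
    [NormedAddCommGroup E] [InnerProductSpace ℝ E] [FiniteDimensional ℝ E] [MeasurableSpace E]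
    [BorelSpace E] {L : α → α → ℝ} {φ : α → E} (hφ : Measurable φ)
    (hconv : Convex ℝ (Set.range φ)) (hL : ∀ t y, L t y = ‖φ t - φ y‖ ^ 2) :
    HasCleanDecomposition L := by
  obtain rfl : L = fun t y => ‖φ t - φ y‖ ^ 2 := by ext; exact hL _ _
  set L : α → α → ℝ := fun t y => ‖φ t - φ y‖ ^ 2
  have hmeas : ∀ P : ProbabilityMeasure α, AEStronglyMeasurable φ (P : Measure α) := fun P =>
    hφ.aestronglyMeasurable
  have hne : ∀ P : ProbabilityMeasure α, Nonempty α := fun P =>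
    (P : Measure α).nonempty_of_neZero
  have hLsymm : ∀ t y, L t y = L y t := fun t y => by simp only [L, norm_sub_rev (φ t)]
  have hflip : ∀ (Q : ProbabilityMeasure α) (t : α),
      ∫ y, L t y ∂(Q : Measure α) = ∫ y, ‖φ y - φ t‖ ^ 2 ∂(Q : Measure α) := fun Q t =>
    integral_congr_ae (Filter.Eventually.of_forall fun y => hLsymm t y)
  have hswap : ∀ Q, ValidPredictionLaw L Q → ValidLabelLaw L Q := fun Q hQ y =>
    (hQ y).congr (Filter.Eventually.of_forall fun t => hLsymm y t)
  have hmean : ∀ P : ProbabilityMeasure α, ∃ s, ValidLabelLaw L P →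
      φ s = ∫ t, φ t ∂(P : Measure α) := by
    intro P
    obtain ⟨o⟩ := hne P
    by_cases hP : ValidLabelLaw L P
    · obtain ⟨s, hs⟩ := Convex.integral_mem_of_finrank _ rfl hconv
        (integrable_of_integrable_norm_sub_sq (hmeas P) (hP o))
        (Filter.Eventually.of_forall fun t => Set.mem_range_self t)
      exact ⟨s, fun _ => hs⟩
    · exact ⟨o, fun h => absurd h hP⟩
  choose ctr hctr using hmean
  have haxis : ∀ P, ValidLabelLaw L P → ∀ z, ∫ t, ‖φ t - z‖ ^ 2 ∂(P : Measure α) =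
      ∫ t, L t (ctr P) ∂(P : Measure α) + ‖φ (ctr P) - z‖ ^ 2 := by
    intro P hP z
    obtain ⟨o⟩ := hne P
    have h := integral_norm_sub_sq (hmeas P) (hP o) z
    rwa [← hctr P hP] at h
  refine ⟨ctr, ctr, fun P hP y => ?_, fun Q hQ t => ?_, fun P Q hP hQ => ?_⟩
  · exact (le_add_of_nonneg_right (sq_nonneg _)).trans_eq (haxis P hP (φ y)).symm
  · have h := haxis Q (hswap Q hQ) (φ t)
    rw [hflip, hflip]
    exact (le_add_of_nonneg_right (sq_nonneg _)).trans_eq h.symm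
  · obtain ⟨o⟩ := hne P
    have hprod : Integrable (fun p : α × α => L p.1 p.2)
        ((P : Measure α).prod (Q : Measure α)) := by
      refine ((((hP o).comp_fst (Q : Measure α)).const_mul 2).add
        (((hswap Q hQ o).comp_snd (P : Measure α)).const_mul 2)).mono' ?_
        (Filter.Eventually.of_forall fun p => ?_)
      · exact (((hφ.comp measurable_fst).sub (hφ.comp measurable_snd)).norm.pow_const
          2).aestronglyMeasurable
      · rw [Real.norm_of_nonneg (sq_nonneg _)]
        exact norm_sub_sq_le_two_mul _ _ _
    refine ⟨hprod, ?_⟩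
    rw [integral_prod _ hprod]
    have hinner : ∀ t, ∫ y, L t y ∂(Q : Measure α) =
        ∫ y, L (ctr Q) y ∂(Q : Measure α) + L t (ctr Q) := by
      intro t
      rw [hflip, hflip, hLsymm t]
      exact haxis Q (hswap Q hQ) (φ t)
    refine (integral_congr_ae (Filter.Eventually.of_forall hinner)).trans ?_
    rw [integral_add (integrable_const _) (hP _)]
    have h := haxis P hP (φ (ctr Q))
    change ∫ t, L t (ctr Q) ∂(P : Measure α) = _ + L (ctr P) (ctr Q) at h
    rw [h]
    simp
    ring

open scoped MatrixOrder in
theorem exists_mulVec_norm_sq_eq_mahalanobisLoss {α : Type*} {d : ℕ} (g : α → Fin d → ℝ)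
    {K : Matrix (Fin d) (Fin d) ℝ} (hK : K.PosSemidef) :
    ∃ B : Matrix (Fin d) (Fin d) ℝ, ∀ t y, mahalanobisLoss g K t y =
      ‖WithLp.toLp 2 (B.mulVec (g t)) - WithLp.toLp 2 (B.mulVec (g y))‖ ^ 2 := by
  obtain ⟨B, rfl⟩ := CStarAlgebra.nonneg_iff_eq_star_mul_self.1 hK.nonneg
  refine ⟨B, fun t y => ?_⟩
  rw [← WithLp.toLp_sub, ← Matrix.mulVec_sub, EuclideanSpace.norm_sq_eq, mahalanobisLoss,
    ← Matrix.mulVec_mulVec, Matrix.dotProduct_mulVec, Matrix.star_eq_conjTranspose,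
    Matrix.conjTranspose_eq_transpose_of_trivial,
    Matrix.vecMul_transpose]
  simp [dotProduct, sq]

theorem mainTheorem2 (d : ℕ) (Y : Set (EuclideanSpace ℝ (Fin d))) :
    (IsSigmaCompact Y →
      ∀ L : Y → Y → ℝ, Continuous (fun p : Y × Y => L p.1 p.2) → IsLoss L →
        (((∀ t y, L t y = L y t) ∧ HasCleanDecomposition L) ↔
          ∃ (g : Y → Fin d → ℝ) (K : Matrix (Fin d) (Fin d) ℝ),
            Function.Injective g ∧ Convex ℝ (Set.range g) ∧ K.PosDef ∧
              ∀ t y, L t y = mahalanobisLoss g K t y)) ∧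
    (Y.Nontrivial →
      (∀ L : Y → Y → ℝ, IsMetricLoss L → ¬ HasCleanDecomposition L) ∧
      ¬ HasCleanDecomposition (zeroOneLoss : Y → Y → ℝ) ∧
      ¬ HasCleanDecomposition (manhattanLoss : Y → Y → ℝ)) := by
  refine ⟨fun hY L hcont hL => ⟨?_, ?_⟩, fun hY => ?_⟩
  · rintro ⟨hsymm, hclean⟩
    refine exists_mahalanobisLoss_of_hasBarycenters hY hcont hL hsymm fun a b w hw => ?_
    obtain ⟨m, -, hm⟩ := hclean.exists_barycenter hL hsymm a b hw
    exact ⟨m, hm⟩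
  · rintro ⟨g, K, -, hg, hK, hLg⟩
    obtain ⟨B, hB⟩ := exists_mulVec_norm_sq_eq_mahalanobisLoss g hK.posSemidef
    have hφ : ∀ t y, L t y =
        ‖WithLp.toLp 2 (B.mulVec (g t)) - WithLp.toLp 2 (B.mulVec (g y))‖ ^ 2 := fun t y =>
      (hLg t y).trans (hB t y)
    refine ⟨fun t y => by rw [hφ, hφ, norm_sub_rev], ?_⟩
    refine hasCleanDecomposition_of_norm_sub_sq (continuous_of_norm_sub_sq hcont hφ).measurable
      ?_ hφ
    rintro _ ⟨a, rfl⟩ _ ⟨b, rfl⟩ p q hp hq hpq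
    obtain ⟨m, hm⟩ := hg ⟨a, rfl⟩ ⟨b, rfl⟩ hp hq hpq
    refine ⟨m, ?_⟩
    simp [hm, Matrix.mulVec_add, Matrix.mulVec_smul]
  · have : Nontrivial Y := hY.coe_sort
    exact ⟨fun L hL => hL.not_hasCleanDecomposition,
      isMetricLoss_zeroOneLoss.not_hasCleanDecomposition,
      isMetricLoss_manhattanLoss.not_hasCleanDecomposition⟩
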